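/- The following decision problem (the \emph{Modulo Problem}) is undecidable. An instance is a finite list of pairs $\langle A_0,B_0\rangle,\ldots,\langle A_{M-1},B_{M-1}\rangle$ of natural numbers (including $0$), where $M>1$. Such an instance determines a function $f:\mathbb{N}\to\mathbb{N}$ by $$f(zM+j)=A_j z+B_j\qquad (z\in\mathbb{N},\ 0\le j<M).$$ The question is whether there exists $N\in\mathbb{N}$ such that $f^N(3)=2$, where $f^0(x)=x$ and $f^{N+1}(x)=f(f^N(x))$. That is, there is no algorithm (computable function) which, given an arbitrary instance, decides whether such an $N$ exists. -/

import Mathlib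

/-- An instance of the Modulo Problem: a finite list `⟨A 0, B 0⟩, …, ⟨A (M-1), B (M-1)⟩` of pairs
of natural numbers, of length `M > 1`. -/
abbrev ModuloInstance : Type := {L : List (ℕ × ℕ) // 1 < L.length}

theorem primrecPred_one_lt_length : PrimrecPred fun L : List (ℕ × ℕ) => 1 < L.length :=
  Primrec.nat_lt.comp (Primrec.const 1) Primrec.list_length

/-- Instances are coded as lists of pairs of natural numbers, in Mathlib's standard coding. -/
instance ModuloInstance.primcodable : Primcodable ModuloInstance :=
  Primcodable.subtype primrecPred_one_lt_length

namespace ModuloInstance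

/-- The modulus `M`, i.e. the number of pairs. -/
def modulus (I : ModuloInstance) : ℕ := I.1.length

theorem modulus_pos (I : ModuloInstance) : 0 < I.modulus := lt_trans Nat.zero_lt_one I.2

/-- The coefficient `A j`. -/
def A (I : ModuloInstance) (j : Fin I.modulus) : ℕ := (I.1.get j).1

/-- The coefficient `B j`. -/
def B (I : ModuloInstance) (j : Fin I.modulus) : ℕ := (I.1.get j).2

/-- The remainder of `x` modulo `M`, as an index of one of the pairs. -/
def residue (I : ModuloInstance) (x : ℕ) : Fin I.modulus :=
  ⟨x % I.modulus, Nat.mod_lt x I.modulus_pos⟩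

/-- The function `f` given by the instance: `f x = A j * z + B j` where `x = z * M + j` and
`j < M`, that is, `z = x / M` and `j = x % M`. -/
def f (I : ModuloInstance) (x : ℕ) : ℕ :=
  I.A (I.residue x) * (x / I.modulus) + I.B (I.residue x)

/-- The defining equation of `f`. -/
theorem f_mul_add (I : ModuloInstance) (z : ℕ) (j : Fin I.modulus) :
    I.f (z * I.modulus + j) = I.A j * z + I.B j := by
  have h1 : I.residue (z * I.modulus + j) = j := by
    apply Fin.ext
    simp [residue, Nat.mod_eq_of_lt j.2]
  have h2 : (z * I.modulus + j) / I.modulus = z := by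
    rw [Nat.mul_comm, Nat.mul_add_div I.modulus_pos, Nat.div_eq_of_lt j.2, Nat.add_zero]
  rw [f, h1, h2]

/-- The instance has a solution: some iterate of `f` maps `3` to `2`. -/
def Solvable (I : ModuloInstance) : Prop := ∃ N : ℕ, I.f^[N] 3 = 2

end ModuloInstance

/-! The halting problem reduces to the Modulo Problem through counter programs, in the manner of
Conway's Collatz-like functions. Loop programs compute every primitive recursive function
(`Computes.of_primrec'`), so one outer loop searches for a witness of any Σ₁ statement
(`exists_search`).

A configuration becomes one number `Q * n + e L`: the prime exponents of `n` hold the registers, and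
`e L` numbers the remaining work, which takes finitely many values (`finite_labels`). A step
multiplies or divides `n` by a fixed prime, or tests divisibility by it, so it is affine on each
residue class of a suitable modulus (`exists_arith_affine`). The class of `3` is never met by a
configuration, so its pair is free to load the input, and halting is sent to `2`. -/

/-- Structured programs for counter machines with registers indexed by `ℕ`. The command
`loop i p` decrements register `i` and runs `p`, as long as register `i` is nonzero. -/
inductive Cmd : Type
  | skip : Cmd
  | inc : ℕ → Cmd
  | seq : Cmd → Cmd → Cmd
  | loop : ℕ → Cmd → Cmd

namespace Cmd

open Function (update)

/-- One step of a program; a configuration consists of the list of commands that remain to be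
executed and the contents of the registers. -/
def step : List Cmd × (ℕ → ℕ) → List Cmd × (ℕ → ℕ)
  | ([], σ) => ([], σ)
  | (skip :: K, σ) => (K, σ)
  | (inc i :: K, σ) => (K, update σ i (σ i + 1))
  | (seq p q :: K, σ) => (p :: q :: K, σ)
  | (loop i p :: K, σ) =>
    if σ i = 0 then (K, σ) else (p :: loop i p :: K, update σ i (σ i - 1))

/-- The command `p` terminates when started with registers `σ`, and leaves registers `τ`. -/
def Runs (p : Cmd) (σ τ : ℕ → ℕ) : Prop := ∀ K, ∃ N, step^[N] (p :: K, σ) = (K, τ)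

theorem iterate_step_nil (σ : ℕ → ℕ) (N : ℕ) : step^[N] ([], σ) = ([], σ) :=
  Function.iterate_fixed rfl N

theorem runs_skip (σ : ℕ → ℕ) : Runs skip σ σ := fun _ => ⟨1, rfl⟩

theorem runs_inc (i : ℕ) (σ : ℕ → ℕ) : Runs (inc i) σ (update σ i (σ i + 1)) := fun _ => ⟨1, rfl⟩

theorem Runs.seq {p q : Cmd} {σ τ υ : ℕ → ℕ} (hp : Runs p σ τ) (hq : Runs q τ υ) :
    Runs (seq p q) σ υ := by
  intro K
  obtain ⟨N, hN⟩ := hp (q :: K)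
  obtain ⟨N', hN'⟩ := hq K
  exact ⟨N' + (N + 1), by rw [Function.iterate_add_apply, Function.iterate_succ_apply]
                          simp only [step]; rw [hN, hN']⟩

/-- The form `N + 1` records that a pass takes at least one step, which drives the descent in
`iterate_loop_ne_nil`. -/
theorem Runs.iterate_loop {p : Cmd} {i : ℕ} {σ τ : ℕ → ℕ} (h0 : σ i ≠ 0)
    (hp : Runs p (update σ i (σ i - 1)) τ) (K : List Cmd) :
    ∃ N, step^[N + 1] (loop i p :: K, σ) = (loop i p :: K, τ) := by
  obtain ⟨N, hN⟩ := hp (loop i p :: K)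
  exact ⟨N, by rw [Function.iterate_succ_apply]; simp only [step, if_neg h0]; exact hN⟩

theorem runs_loop {p : Cmd} {i : ℕ} (s : ℕ → ℕ → ℕ) (N : ℕ)
    (h : ∀ j < N, s j i ≠ 0 ∧ Runs p (update (s j) i (s j i - 1)) (s (j + 1)))
    (hN : s N i = 0) : Runs (loop i p) (s 0) (s N) := by
  intro K
  have key : ∀ j ≤ N, ∃ T, step^[T] (loop i p :: K, s 0) = (loop i p :: K, s j) := by
    intro j
    induction j with
    | zero => exact fun _ => ⟨0, rfl⟩
    | succ j ih =>
      intro hj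
      obtain ⟨T, hT⟩ := ih (by omega)
      obtain ⟨T', hT'⟩ := (h j hj).2.iterate_loop (h j hj).1 K
      exact ⟨T' + 1 + T, by rw [Function.iterate_add_apply, hT, hT']⟩
  obtain ⟨T, hT⟩ := key N le_rfl
  exact ⟨T + 1, by rw [Function.iterate_succ_apply', hT]; simp [step, hN]⟩

/-- If the guard of a loop is never zero when the loop is entered, the loop does not terminate. -/
theorem iterate_loop_ne_nil {p : Cmd} {i : ℕ} (s : ℕ → ℕ → ℕ)
    (h : ∀ j, s j i ≠ 0 ∧ Runs p (update (s j) i (s j i - 1)) (s (j + 1))) (K : List Cmd)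
    (N : ℕ) : (step^[N] (loop i p :: K, s 0)).1 ≠ [] := by
  suffices ∀ j, (step^[N] (loop i p :: K, s j)).1 ≠ [] from this 0
  induction N using Nat.strong_induction_on with
  | _ N ih =>
    intro j hnil
    obtain ⟨T, hT⟩ := (h j).2.iterate_loop (h j).1 K
    -- Halting within this pass would persist to its end, where work remains; halting later leaves a
    -- smaller `N` for the next pass.
    rcases Nat.lt_or_ge N (T + 1) with hlt | hge
    · obtain ⟨d, hd⟩ := Nat.exists_eq_add_of_lt hlt
      have h1 : step^[T + 1] (loop i p :: K, s j) =
          step^[d + 1] (step^[N] (loop i p :: K, s j)) := by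
        rw [← Function.iterate_add_apply]; congr 1; omega
      have h2 : step^[N] (loop i p :: K, s j) = ([], (step^[N] (loop i p :: K, s j)).2) :=
        Prod.ext hnil rfl
      rw [h2, iterate_step_nil, hT] at h1
      simp at h1
    · obtain ⟨d, rfl⟩ := Nat.exists_eq_add_of_le' hge
      rw [Function.iterate_add_apply, hT] at hnil
      exact ih d (by omega) (j + 1) hnil

/-- Set register `i` to zero. -/
def clear (i : ℕ) : Cmd := loop i skip

theorem runs_clear (i : ℕ) (σ : ℕ → ℕ) : Runs (clear i) σ (update σ i 0) := by
  have := runs_loop (p := skip) (i := i) (fun j => update σ i (σ i - j)) (σ i)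
    (fun j hj => ⟨by simp; omega, by
      convert runs_skip _ using 1
      simp [Nat.sub_sub]⟩) (by simp)
  simpa [clear] using this

/-- Add register `i` to the register `r`, with `t` as a scratch register. -/
def addTo (i r t : ℕ) : Cmd :=
  seq (loop i (seq (inc r) (inc t))) (loop t (inc i))

/-- The first loop moves `i` into both `r` and `t`; the second moves `t` back, restoring `i` and
emptying `t`. -/
theorem runs_addTo {i r t : ℕ} (hir : i ≠ r) (hit : i ≠ t) (hrt : r ≠ t) (σ : ℕ → ℕ)
    (ht : σ t = 0) : Runs (addTo i r t) σ (update σ r (σ r + σ i)) := by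
  have h1 := runs_loop (p := seq (inc r) (inc t)) (i := i)
    (fun j => update (update (update σ i (σ i - j)) r (σ r + j)) t j) (σ i)
    (fun j hj => ⟨by simp [*]; omega, by
      convert (runs_inc r _).seq (runs_inc t _) using 1
      ext x
      simp only [Function.update_apply]
      grind⟩) (by simp [*])
  have h2 := runs_loop (p := inc i) (i := t)
    (fun j => update (update (update σ i j) r (σ r + σ i)) t (σ i - j)) (σ i)
    (fun j hj => ⟨by simp; omega, by
      convert runs_inc i _ using 1
      ext x
      simp only [Function.update_apply]
      grind⟩) (by simp)
  have h3 : Runs (addTo i r t) _ _ := h1.seq (by convert h2 using 1; ext x; simp)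
  convert h3 using 1
  · ext x
    simp only [Function.update_apply]
    grind
  · ext x
    simp only [Function.update_apply]
    grind

/-! ### Primitive recursive functions as loop programs -/

/-- The function `f` can be computed by programs: for every choice of argument registers `a`, of an
output register `r` that is initially zero, and of a bound `b` above which registers are zero, some
program sets register `r` to the value of `f` and leaves the other registers as they were. -/
def Computes {n : ℕ} (f : List.Vector ℕ n → ℕ) : Prop :=
  ∀ (a : List.Vector ℕ n) (r b : ℕ), (∀ i, a.get i < b) → (∀ i, a.get i ≠ r) → r < b →
    ∃ p, ∀ σ : ℕ → ℕ, (∀ j, b ≤ j → σ j = 0) → σ r = 0 → Runs p σ (update σ r (f (a.map σ)))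

theorem map_congr_get {n : ℕ} {a : List.Vector ℕ n} {σ τ : ℕ → ℕ}
    (h : ∀ i, σ (a.get i) = τ (a.get i)) : a.map σ = a.map τ :=
  List.Vector.ext fun i => by simp [h]

theorem computes_zero : Computes (n := 0) fun _ => 0 := fun _ r _ _ _ _ =>
  ⟨skip, fun σ _ h => by simpa [← h] using runs_skip σ⟩

theorem computes_succ : Computes (n := 1) fun v => v.head.succ := fun a r b hb hr hrb =>
  ⟨seq (addTo a.head r b) (inc r), fun σ hσ h => by
    have hb := hb 0
    have hr := hr 0
    rw [List.Vector.get_zero] at hb hr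
    convert (runs_addTo hr hb.ne hrb.ne σ (hσ b le_rfl)).seq (runs_inc r _) using 1
    simp [h]⟩

theorem computes_get {n : ℕ} (i : Fin n) : Computes fun v => v.get i := fun a r b hb hr hrb =>
  ⟨addTo (a.get i) r b, fun σ hσ h => by
    convert runs_addTo (hr i) (hb i).ne hrb.ne σ (hσ b le_rfl) using 1
    simp [h]⟩

/-- Clear the registers `b, …, b + n - 1`. -/
def clearBlock (b : ℕ) : ℕ → Cmd
  | 0 => skip
  | n + 1 => seq (clearBlock b n) (clear (b + n))

theorem runs_clearBlock (b n : ℕ) (σ : ℕ → ℕ) :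
    Runs (clearBlock b n) σ fun j => if b ≤ j ∧ j < b + n then 0 else σ j := by
  induction n with
  | zero =>
    rw [clearBlock]
    convert runs_skip σ using 1
    ext j
    grind
  | succ n ih =>
    rw [clearBlock]
    convert ih.seq (runs_clear (b + n) _) using 1
    ext j
    simp only [Function.update_apply]
    grind

/-- Intermediate values for composition: each `g i` writes to `b + i` and takes its scratch space
from `b + n` on, beyond the whole block. -/
theorem exists_runs_block {m : ℕ} {g : ℕ → List.Vector ℕ m → ℕ} (hg : ∀ i, Computes (g i))
    (a : List.Vector ℕ m) (b n : ℕ) (hb : ∀ i, a.get i < b) (k : ℕ) (hk : k ≤ n) :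
    ∃ p, ∀ σ : ℕ → ℕ, (∀ j, b ≤ j → σ j = 0) →
      Runs p σ fun j => if b ≤ j ∧ j < b + k then g (j - b) (a.map σ) else σ j := by
  induction k with
  | zero =>
    refine ⟨skip, fun σ _ => ?_⟩
    convert runs_skip σ using 1
    ext j
    grind
  | succ k ih =>
    obtain ⟨p, hp⟩ := ih (by omega)
    obtain ⟨q, hq⟩ := hg k a (b + k) (b + n) (fun i => by have := hb i; omega)
      (fun i => by have := hb i; omega) (by omega)
    refine ⟨seq p q, fun σ hσ => ?_⟩
    have h1 := hq (fun j => if b ≤ j ∧ j < b + k then g (j - b) (a.map σ) else σ j)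
      (fun j hj => (if_neg (by omega)).trans (hσ j (by omega)))
      ((if_neg (by omega)).trans (hσ (b + k) (by omega)))
    have hv : a.map (fun j => if b ≤ j ∧ j < b + k then g (j - b) (a.map σ) else σ j) = a.map σ :=
      map_congr_get fun i => by simp [(hb i).not_ge]
    rw [hv] at h1
    convert (hp σ hσ).seq h1 using 1
    ext j
    simp only [Function.update_apply]
    grind

theorem Computes.comp {m n : ℕ} {f : List.Vector ℕ n → ℕ} {g : Fin n → List.Vector ℕ m → ℕ}
    (hf : Computes f) (hg : ∀ i, Computes (g i)) :
    Computes fun a => f (List.Vector.ofFn fun i => g i a) := by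
  intro a r b hb hr hrb
  rcases Nat.eq_zero_or_pos n with rfl | hn
  · obtain ⟨p, hp⟩ := hf List.Vector.nil r b (fun i => i.elim0) (fun i => i.elim0) hrb
    exact ⟨p, fun σ hσ h => by simpa [List.Vector.ofFn] using hp σ hσ h⟩
  let g' : ℕ → List.Vector ℕ m → ℕ := fun i => if h : i < n then g ⟨i, h⟩ else g ⟨0, hn⟩
  have hg' : ∀ i, Computes (g' i) := fun i => by
    by_cases h : i < n <;> simp [g', h, hg]
  obtain ⟨p, hp⟩ := exists_runs_block hg' a b n hb n le_rfl
  obtain ⟨q, hq⟩ := hf (List.Vector.ofFn fun i => b + i) r (b + n) (fun i => by simp)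
    (fun i => by simp; omega) (by omega)
  refine ⟨seq (seq p q) (clearBlock b n), fun σ hσ h => ?_⟩
  have h1 := hq (fun j => if b ≤ j ∧ j < b + n then g' (j - b) (a.map σ) else σ j)
    (fun j hj => (if_neg (by omega)).trans (hσ j (by omega))) ((if_neg (by omega)).trans h)
  convert ((hp σ hσ).seq h1).seq (runs_clearBlock b n _) using 1
  · have hv : (List.Vector.ofFn fun i : Fin n => b + (i : ℕ)).map
        (fun j => if b ≤ j ∧ j < b + n then g' (j - b) (a.map σ) else σ j) =
        List.Vector.ofFn fun i => g i (a.map σ) :=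
      List.Vector.ext fun i => by simp [g']
    rw [hv]
    ext j
    simp only [Function.update_apply]
    grind

theorem get_cons_cons {n : ℕ} {P : ℕ → Prop} {x y : ℕ} {a : List.Vector ℕ n} (hx : P x) (hy : P y)
    (ha : ∀ i, P (a.get i)) (i : Fin (n + 2)) : P ((x ::ᵥ y ::ᵥ a).get i) := by
  refine Fin.cases (by simpa) (fun i => ?_) i
  refine Fin.cases (by simpa) (fun i => ?_) i
  simpa using ha i

/-- One round of the recursion: `r` holds the current value, `b` the recursion index, `b + 1` the
enclosing loop's counter, and `b + 2` the new value until it is moved to `r`. -/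
theorem Computes.exists_prec_body {n : ℕ} {g : List.Vector ℕ (n + 2) → ℕ} (hg : Computes g)
    (a : List.Vector ℕ n) (r b : ℕ) (hb : ∀ i, a.get i < b) (hr : ∀ i, a.get i ≠ r) (hrb : r < b) :
    ∃ p, ∀ (σ : ℕ → ℕ), (∀ j, b ≤ j → σ j = 0) → ∀ x y c,
      Runs p (update (update (update σ r x) b y) (b + 1) c)
        (update (update (update σ r (g (y ::ᵥ x ::ᵥ a.map σ))) b (y + 1)) (b + 1) c) := by
  obtain ⟨p, hp⟩ := hg (b ::ᵥ r ::ᵥ a) (b + 2) (b + 3)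
    (get_cons_cons (P := (· < b + 3)) (by omega) (by omega) fun i => by have := hb i; omega)
    (get_cons_cons (P := (· ≠ b + 2)) (by omega) (by omega) fun i => by have := hb i; omega)
    (by omega)
  refine ⟨seq (seq (seq (seq p (clear r)) (addTo (b + 2) r (b + 3))) (clear (b + 2))) (inc b),
    fun σ hσ x y c => ?_⟩
  have hv : (b ::ᵥ r ::ᵥ a).map (update (update (update σ r x) b y) (b + 1) c) =
      y ::ᵥ x ::ᵥ a.map σ := by
    rw [List.Vector.map_cons, List.Vector.map_cons, map_congr_get (τ := σ)]
    · congr 1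
      · simp
      · congr 1
        rw [Function.update_of_ne (by omega), Function.update_of_ne (by omega),
          Function.update_self]
    · intro i
      have := hb i
      rw [Function.update_of_ne (by omega), Function.update_of_ne (by omega),
        Function.update_of_ne (hr i)]
  have h1 := hp (update (update (update σ r x) b y) (b + 1) c)
    (fun j hj => by simp only [Function.update_apply]; grind)
    (by simp only [Function.update_apply]; grind)
  rw [hv] at h1
  generalize g (y ::ᵥ x ::ᵥ a.map σ) = z at h1 ⊢
  have h2 := h1.seq (runs_clear r _)
  have h3 := h2.seq (runs_addTo (i := b + 2) (r := r) (t := b + 3) (by omega) (by omega)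
    (by omega) _ (by simp only [Function.update_apply]; grind))
  convert (h3.seq (runs_clear (b + 2) _)).seq (runs_inc b _) using 1
  ext j
  simp only [Function.update_apply]
  grind

theorem Computes.prec {n : ℕ} {f : List.Vector ℕ n → ℕ} {g : List.Vector ℕ (n + 2) → ℕ}
    (hf : Computes f) (hg : Computes g) :
    Computes fun v : List.Vector ℕ (n + 1) =>
      v.head.rec (f v.tail) fun y IH => g (y ::ᵥ IH ::ᵥ v.tail) := by
  intro a r b hb hr hrb
  have hb0 : a.head < b := by simpa using hb 0
  have hr0 : a.head ≠ r := by simpa using hr 0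
  have hbt : ∀ i : Fin n, a.tail.get i < b := fun i => by simpa using hb i.succ
  have hrt : ∀ i : Fin n, a.tail.get i ≠ r := fun i => by simpa using hr i.succ
  obtain ⟨p, hp⟩ := hf a.tail r b hbt hrt hrb
  obtain ⟨q, hq⟩ := hg.exists_prec_body a.tail r b hbt hrt hrb
  refine ⟨seq (seq (seq p (addTo a.head (b + 1) (b + 2))) (loop (b + 1) q)) (clear b),
    fun σ hσ h => ?_⟩
  beta_reduce
  rw [List.Vector.head_map, List.Vector.tail_map]
  obtain ⟨R, hR, hR0, hR1⟩ : ∃ R : ℕ → ℕ,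
      (∀ j, Nat.rec (f (a.tail.map σ)) (fun y IH => g (y ::ᵥ IH ::ᵥ a.tail.map σ)) j = R j) ∧
      f (a.tail.map σ) = R 0 ∧ ∀ j, g (j ::ᵥ R j ::ᵥ a.tail.map σ) = R (j + 1) :=
    ⟨fun j => Nat.rec (f (a.tail.map σ)) (fun y IH => g (y ::ᵥ IH ::ᵥ a.tail.map σ)) j,
      fun _ => rfl, rfl, fun _ => rfl⟩
  rw [hR]
  have h1 := (hp σ hσ h).seq (runs_addTo (i := a.head) (r := b + 1) (t := b + 2) (by omega)
    (by omega) (by omega) _ (by simp only [Function.update_apply]; grind))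
  rw [hR0] at h1
  have h2 := runs_loop (i := b + 1) (p := q)
    (fun j => update (update (update σ r (R j)) b j) (b + 1) (σ a.head - j)) (σ a.head)
    (fun j hj => ⟨by simpa using Nat.sub_ne_zero_of_lt hj, by
      simpa [hR1, Nat.sub_sub] using hq σ hσ (R j) j (σ a.head - (j + 1))⟩) (by simp)
  have h3 : update (update (update σ r (R 0)) b 0) (b + 1) (σ a.head - 0) =
      update (update σ r (R 0)) (b + 1)
        (update σ r (R 0) (b + 1) + update σ r (R 0) a.head) := by
    ext j
    simp only [Function.update_apply]
    grind
  rw [h3] at h2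
  convert (h1.seq h2).seq (runs_clear b _) using 1
  ext j
  simp only [Function.update_apply]
  grind

theorem Computes.of_primrec' {n : ℕ} {f : List.Vector ℕ n → ℕ} (hf : Nat.Primrec' f) :
    Computes f := by
  induction hf with
  | zero => exact computes_zero
  | succ => exact computes_succ
  | get i => exact computes_get i
  | comp _ _ _ hf hg => exact hf.comp hg
  | prec _ _ hf hg => exact hf.prec hg

/-! ### Unbounded search -/

/-- Registers with input `m` for the unbounded search. -/
def initial (m : ℕ) : ℕ → ℕ := update (update (fun _ => 0) 0 m) 1 1

/-- Unbounded search: some program, started with `m` in register `0` and `1` in register `1`, halts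
if and only if `D k m` holds for some `k`. -/
theorem exists_search {D : ℕ → ℕ → Bool} (hD : Primrec₂ D) :
    ∃ p, ∀ m, (∃ N, (step^[N] ([p], initial m)).1 = []) ↔ ∃ k, D k m = true := by
  have hh : Nat.Primrec' fun v : List.Vector ℕ 2 => cond (D v.head v.tail.head) 0 1 :=
    Nat.Primrec'.of_prim (Primrec.cond (hD.comp Primrec.vector_head
      (Primrec.vector_head.comp Primrec.vector_tail)) (Primrec.const 0) (Primrec.const 1))
  obtain ⟨p, hp⟩ := Computes.of_primrec' hh (2 ::ᵥ 0 ::ᵥ List.Vector.nil) 1 3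
    (get_cons_cons (P := (· < 3)) (by omega) (by omega) fun i => i.elim0)
    (get_cons_cons (P := (· ≠ 1)) (by omega) (by omega) fun i => i.elim0) (by omega)
  simp only [List.Vector.map_cons, List.Vector.head_cons, List.Vector.tail_cons] at hp
  refine ⟨loop 1 (seq p (inc 2)), fun m => ?_⟩
  -- The guard before pass `j`: initially `1`, afterwards the outcome of testing `j - 1`. As it is
  -- at most `1`, the loop's decrement clears it to receive the next output.
  let flag : ℕ → ℕ := fun j => j.casesOn 1 fun k => cond (D k m) 0 1
  let s : ℕ → ℕ → ℕ := fun j => update (update (update (fun _ => 0) 0 m) 1 (flag j)) 2 j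
  have hs0 : s 0 = initial m := by
    ext x
    have hf0 : flag 0 = 1 := rfl
    simp only [s, initial, hf0, Function.update_apply]
    grind
  have hs1 : ∀ j, s j 1 = flag j := fun j => by simp [s]
  have hflag : ∀ j, flag j ≤ 1 := by
    rintro (_ | k)
    · simp [flag]
    · cases h : D k m <;> simp [flag, h]
  have hbody : ∀ j, Runs (seq p (inc 2)) (update (s j) 1 (s j 1 - 1)) (s (j + 1)) := by
    intro j
    have h1 : s j 1 - 1 = 0 := by rw [hs1]; have := hflag j; omega
    have h2 := hp (update (s j) 1 (s j 1 - 1)) (fun x hx => by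
      simp only [s, Function.update_apply]; grind) (by simp [h1])
    convert h2.seq (runs_inc 2 _) using 1
    have h3 : flag (j + 1) = cond (D j m) 0 1 := rfl
    ext x
    simp only [s, Function.update_apply, h3]
    grind
  rw [← hs0]
  constructor
  · rintro ⟨N, hN⟩
    by_contra! hno
    refine iterate_loop_ne_nil s (fun j => ⟨?_, hbody j⟩) [] N hN
    rw [hs1]
    cases j with
    | zero => simp [flag]
    | succ k => simp [flag, hno]
  · intro hex
    classical
    obtain ⟨N, hN⟩ := runs_loop (p := seq p (inc 2)) (i := 1) s (Nat.find hex + 1)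
      (fun j hj => ⟨by
        rw [hs1]
        cases j with
        | zero => simp [flag]
        | succ k => simp [flag, Nat.find_min hex (show k < Nat.find hex by omega)], hbody j⟩)
      ((hs1 _).trans (by simp [flag, Nat.find_spec hex])) []
    exact ⟨N, by rw [hN]⟩

/-! ### Finiteness of the control states -/

/-- The lists of commands that occur as remaining work during the execution of `p :: K`, before
only `K` is left. -/
def labels : Cmd → List Cmd → Set (List Cmd)
  | skip, K => {skip :: K}
  | inc i, K => {inc i :: K}
  | seq p q, K => insert (seq p q :: K) (labels p (q :: K) ∪ labels q K)
  | loop i p, K => insert (loop i p :: K) (labels p (loop i p :: K))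

theorem finite_labels (p : Cmd) (K : List Cmd) : (labels p K).Finite := by
  induction p generalizing K with
  | skip => exact Set.finite_singleton _
  | inc i => exact Set.finite_singleton _
  | seq p q hp hq => exact ((hp _).union (hq _)).insert _
  | loop i p hp => exact (hp _).insert _

theorem mem_labels_self (p : Cmd) (K : List Cmd) : p :: K ∈ labels p K := by
  cases p <;> simp [labels]

theorem step_mem_labels (p : Cmd) {K L : List Cmd} (hL : L ∈ labels p K) (σ : ℕ → ℕ) :
    (step (L, σ)).1 ∈ insert K (labels p K) := by
  induction p generalizing K with
  | skip =>
    rw [labels, Set.mem_singleton_iff] at hL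
    simp [hL, step]
  | inc i =>
    rw [labels, Set.mem_singleton_iff] at hL
    simp [hL, step]
  | seq p q hp hq =>
    rcases hL with rfl | hL | hL
    · simp [step, labels, mem_labels_self]
    · rcases hp hL with h | h
      · rw [h]
        exact Or.inr (Or.inr (Or.inr (mem_labels_self q K)))
      · exact Or.inr (Or.inr (Or.inl h))
    · rcases hq hL with h | h
      · exact Or.inl h
      · exact Or.inr (Or.inr (Or.inr h))
  | loop i p hp =>
    rcases hL with rfl | hL
    · by_cases h : σ i = 0 <;> simp [step, labels, mem_labels_self, h]
    · rcases hp hL with h | h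
      · rw [h]
        exact Or.inr (Or.inl rfl)
      · exact Or.inr (Or.inr h)

/-! ### Arithmetic simulation by prime exponents -/

/-- The number `n` codes the registers `σ` by the exponents in its prime factorization. -/
def Codes (n : ℕ) (σ : ℕ → ℕ) : Prop :=
  n ≠ 0 ∧ ∀ i, n.factorization (Nat.nth Nat.Prime i) = σ i

theorem codes_initial (m : ℕ) :
    Codes (Nat.nth Nat.Prime 0 ^ m * Nat.nth Nat.Prime 1) (initial m) := by
  have h0 := Nat.prime_nth_prime 0
  have h1 := Nat.prime_nth_prime 1
  have hinj := Nat.nth_injective Nat.infinite_setOfPred_prime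
  refine ⟨mul_ne_zero (pow_ne_zero _ h0.ne_zero) h1.ne_zero, fun i => ?_⟩
  rw [Nat.factorization_mul (pow_ne_zero _ h0.ne_zero) h1.ne_zero, h0.factorization_pow,
    h1.factorization]
  simp only [Finsupp.add_apply, Finsupp.single_apply, hinj.eq_iff, initial, Function.update_apply]
  grind

theorem Codes.mul {n : ℕ} {σ : ℕ → ℕ} (h : Codes n σ) (i : ℕ) :
    Codes (n * Nat.nth Nat.Prime i) (update σ i (σ i + 1)) := by
  have hp := Nat.prime_nth_prime i
  have hinj := Nat.nth_injective Nat.infinite_setOfPred_prime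
  refine ⟨mul_ne_zero h.1 hp.ne_zero, fun j => ?_⟩
  rw [Nat.factorization_mul h.1 hp.ne_zero, hp.factorization]
  simp only [Finsupp.add_apply, Finsupp.single_apply, hinj.eq_iff, h.2, Function.update_apply]
  grind

theorem Codes.dvd_iff {n : ℕ} {σ : ℕ → ℕ} (h : Codes n σ) (i : ℕ) :
    Nat.nth Nat.Prime i ∣ n ↔ σ i ≠ 0 := by
  rw [(Nat.prime_nth_prime i).dvd_iff_one_le_factorization h.1, h.2, Nat.one_le_iff_ne_zero]

theorem Codes.div {n : ℕ} {σ : ℕ → ℕ} (h : Codes n σ) {i : ℕ} (hi : σ i ≠ 0) :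
    Codes (n / Nat.nth Nat.Prime i) (update σ i (σ i - 1)) := by
  have hp := Nat.prime_nth_prime i
  have hinj := Nat.nth_injective Nat.infinite_setOfPred_prime
  have hd := (h.dvd_iff i).2 hi
  refine ⟨(Nat.div_pos (Nat.le_of_dvd (Nat.pos_of_ne_zero h.1) hd) hp.pos).ne', fun j => ?_⟩
  rw [Nat.factorization_div hd, hp.factorization]
  simp only [Finsupp.tsub_apply, Finsupp.single_apply, hinj.eq_iff, h.2, Function.update_apply]
  grind

/-- A map on natural numbers that simulates the steps of programs. The configuration with remaining
commands `L` and registers coded by `n` is represented by `Q * n + e L`, where `e` numbers the lists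
of commands, and `d` is its inverse. Terminal configurations are mapped to `2`. -/
noncomputable def arith (Q : ℕ) (e : List Cmd → ℕ) (d : ℕ → List Cmd) (x : ℕ) : ℕ :=
  match d (x % Q) with
  | [] => 2
  | skip :: K => Q * (x / Q) + e K
  | inc i :: K => Q * (x / Q * Nat.nth Nat.Prime i) + e K
  | seq p q :: K => Q * (x / Q) + e (p :: q :: K)
  | loop i p :: K =>
    if Nat.nth Nat.Prime i ∣ x / Q then Q * (x / Q / Nat.nth Nat.Prime i) + e (p :: loop i p :: K)
    else Q * (x / Q) + e K

section Simulation

variable {Q : ℕ} {e : List Cmd → ℕ} {d : ℕ → List Cmd} {S : Set (List Cmd)}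

/-- The map `arith` is affine on each residue class of a suitable modulus. -/
theorem exists_arith_affine (hQ : 3 < Q) (e : List Cmd → ℕ) (d : ℕ → List Cmd) :
    ∃ (M : ℕ) (A B : ℕ → ℕ), Q ∣ M ∧ 3 < M ∧
      ∀ j < M, ∀ z, arith Q e d (z * M + j) = A j * z + B j := by
  let u : List Cmd → ℕ := fun
    | loop i _ :: _ => Nat.nth Nat.Prime i
    | _ => 1
  have hu : ∀ L, 0 < u L := fun L => by
    rcases L with _ | ⟨_ | _ | _ | _, K⟩ <;> simp [u, (Nat.prime_nth_prime _).pos]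
  -- With every tested prime dividing `P`, the residue modulo `Q * P` decides both the command and
  -- the outcome of its test.
  let P := ∏ q ∈ Finset.range Q, u (d q)
  have hP : 0 < P := Finset.prod_pos fun q _ => hu _
  suffices h : ∀ j < Q * P, ∃ A B, ∀ z, arith Q e d (z * (Q * P) + j) = A * z + B by
    choose! A B hAB using h
    exact ⟨Q * P, A, B, dvd_mul_right _ _, hQ.trans_le (Nat.le_mul_of_pos_right _ hP), hAB⟩
  intro j _
  have hmod : ∀ z, (z * (Q * P) + j) % Q = j % Q := fun z => by
    rw [show z * (Q * P) + j = j + Q * (z * P) by ring, Nat.add_mul_mod_self_left]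
  have hdiv : ∀ z, (z * (Q * P) + j) / Q = z * P + j / Q := fun z => by
    rw [show z * (Q * P) + j = j + Q * (z * P) by ring, Nat.add_mul_div_left _ _ (by omega),
      add_comm]
  have hdvd : u (d (j % Q)) ∣ P :=
    Finset.dvd_prod_of_mem (fun q => u (d q)) (Finset.mem_range.2 (Nat.mod_lt _ (by omega)))
  simp only [arith, hmod, hdiv]
  generalize d (j % Q) = L at hdvd ⊢
  rcases L with _ | ⟨_ | i | ⟨p, q⟩ | ⟨i, p⟩, K⟩
  · exact ⟨0, 2, fun z => by simp⟩
  · exact ⟨Q * P, Q * (j / Q) + e K, fun z => by simp only; ring⟩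
  · exact ⟨Q * P * Nat.nth Nat.Prime i, Q * (j / Q * Nat.nth Nat.Prime i) + e K,
      fun z => by simp only; ring⟩
  · exact ⟨Q * P, Q * (j / Q) + e (p :: q :: K), fun z => by simp only; ring⟩
  · obtain ⟨P', hP'⟩ : Nat.nth Nat.Prime i ∣ P := hdvd
    have hiff : ∀ z, Nat.nth Nat.Prime i ∣ z * P + j / Q ↔ Nat.nth Nat.Prime i ∣ j / Q := fun z =>
      (Nat.dvd_add_right (Dvd.dvd.mul_left ⟨P', hP'⟩ z))
    simp only [hiff]
    by_cases h : Nat.nth Nat.Prime i ∣ j / Q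
    · obtain ⟨c, hc⟩ := h
      refine ⟨Q * P', Q * c + e (p :: loop i p :: K), fun z => ?_⟩
      have : (z * P + j / Q) / Nat.nth Nat.Prime i = z * P' + c := by
        rw [hc, hP', show z * (Nat.nth Nat.Prime i * P') + Nat.nth Nat.Prime i * c =
          Nat.nth Nat.Prime i * (z * P' + c) by ring,
          Nat.mul_div_cancel_left _ (Nat.prime_nth_prime i).pos]
      rw [if_pos ⟨c, hc⟩, this]
      ring
    · exact ⟨Q * P, Q * (j / Q) + e K, fun z => by rw [if_neg h]; ring⟩

/-- The number `x` represents the configuration `c`. -/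
def Represents (Q : ℕ) (e : List Cmd → ℕ) (x : ℕ) (c : List Cmd × (ℕ → ℕ)) : Prop :=
  ∃ n, Codes n c.2 ∧ x = Q * n + e c.1

theorem arith_step (hd : ∀ L ∈ S, d (e L) = L ∧ e L < Q) {x : ℕ} {c : List Cmd × (ℕ → ℕ)}
    (hc : c.1 ∈ S) (hne : c.1 ≠ []) (h : Represents Q e x c) :
    Represents Q e (arith Q e d x) (step c) := by
  obtain ⟨L, σ⟩ := c
  obtain ⟨n, hn, rfl⟩ := h
  obtain ⟨hdL, heL⟩ := hd L hc
  have hmod : (Q * n + e L) % Q = e L := by rw [Nat.mul_add_mod, Nat.mod_eq_of_lt heL]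
  have hdiv : (Q * n + e L) / Q = n := by
    rw [Nat.mul_add_div (by omega), Nat.div_eq_of_lt heL, add_zero]
  simp only [arith, hmod, hdiv, hdL]
  rcases L with _ | ⟨_ | i | ⟨p, q⟩ | ⟨i, p⟩, K⟩
  · exact absurd rfl hne
  · exact ⟨n, hn, rfl⟩
  · exact ⟨_, hn.mul i, rfl⟩
  · exact ⟨n, hn, rfl⟩
  · simp only [hn.dvd_iff, step]
    by_cases hi : σ i = 0
    · simp only [hi, ne_eq, not_true, if_false, if_true]
      exact ⟨n, hn, rfl⟩
    · simp only [hi, ne_eq, not_false_eq_true, if_false, if_true]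
      exact ⟨_, hn.div hi, rfl⟩

theorem arith_eq_two (hd : ∀ L ∈ S, d (e L) = L ∧ e L < Q) (hS : [] ∈ S) {x : ℕ} {σ : ℕ → ℕ}
    (h : Represents Q e x ([], σ)) : arith Q e d x = 2 := by
  obtain ⟨n, -, rfl⟩ := h
  obtain ⟨hd0, he0⟩ := hd _ hS
  simp only [arith, Nat.mul_add_mod, Nat.mod_eq_of_lt he0, hd0]

/-- A map that agrees with `arith` on representations of configurations, and maps `3` to the
representation of an initial configuration, reaches `2` from `3` if and only if the program halts. -/
theorem iterate_three_eq_two_iff (hd : ∀ L ∈ S, d (e L) = L ∧ e L < Q) (he : ∀ L ∈ S, 4 ≤ e L)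
    (hS : [] ∈ S) (hstep : ∀ c : List Cmd × (ℕ → ℕ), c.1 ∈ S → (step c).1 ∈ S) {f : ℕ → ℕ}
    (hf : ∀ x, 4 ≤ x % Q → f x = arith Q e d x) {c : List Cmd × (ℕ → ℕ)} (hc : c.1 ∈ S)
    (h3 : Represents Q e (f 3) c) :
    (∃ N, f^[N] 3 = 2) ↔ ∃ N, (step^[N] c).1 = [] := by
  have hmem : ∀ N, (step^[N] c).1 ∈ S := fun N => by
    induction N with
    | zero => exact hc
    | succ N ih => rw [Function.iterate_succ_apply']; exact hstep _ ih
  have hfx : ∀ {x N}, Represents Q e x (step^[N] c) → 4 ≤ x ∧ f x = arith Q e d x := by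
    rintro _ N ⟨n, -, rfl⟩
    have h4 := he _ (hmem N)
    refine ⟨by omega, hf _ ?_⟩
    rwa [Nat.mul_add_mod, Nat.mod_eq_of_lt (hd _ (hmem N)).2]
  have hrep : ∀ N, (∀ k < N, (step^[k] c).1 ≠ []) →
      Represents Q e (f^[N + 1] 3) (step^[N] c) := fun N => by
    induction N with
    | zero => exact fun _ => h3
    | succ N ih =>
      intro h
      have h1 := ih fun k hk => h k (by omega)
      rw [Function.iterate_succ_apply' f, Function.iterate_succ_apply' step, (hfx h1).2]
      exact arith_step hd (hmem N) (h N (by omega)) h1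
  constructor
  · rintro ⟨N, hN⟩
    by_contra! hno
    rcases N with _ | N
    -- Zero iterations give `3`; all later iterates represent configurations and are at least `4`,
    -- unless the program halts.
    · simp at hN
    · have := (hfx (hrep N fun k _ => hno k)).1
      omega
  · intro hex
    classical
    have h1 := hrep (Nat.find hex) fun k hk => Nat.find_min hex hk
    refine ⟨Nat.find hex + 1 + 1, ?_⟩
    rw [Function.iterate_succ_apply', (hfx h1).2]
    have h2 : step^[Nat.find hex] c = ([], (step^[Nat.find hex] c).2) :=
      Prod.ext (Nat.find_spec hex) rfl
    rw [h2] at h1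
    exact arith_eq_two hd hS h1

/-- The shift by `4` keeps the codes away from the special values `2` and `3`. -/
theorem exists_numbering (hS : S.Finite) :
    ∃ (Q : ℕ) (e : List Cmd → ℕ) (d : ℕ → List Cmd), 3 < Q ∧
      (∀ L ∈ S, d (e L) = L ∧ e L < Q) ∧ ∀ L ∈ S, 4 ≤ e L := by
  classical
  let l := hS.toFinset.toList
  refine ⟨l.length + 4, fun L => l.idxOf L + 4, fun q => l.getD (q - 4) [], by omega, ?_, ?_⟩
  · intro L hL
    have hl : l.idxOf L < l.length := List.idxOf_lt_length_of_mem (by simpa [l] using hL)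
    exact ⟨by simp [hl], Nat.add_lt_add_right hl 4⟩
  · exact fun L _ => Nat.le_add_left _ _

end Simulation

/-! ### Reduction from the halting problem -/

/-- Some modulo instances, which differ only in the value at `3`, are solvable if and only if the
program `p` halts on the corresponding input. -/
theorem exists_instances (p : Cmd) :
    ∃ (L₁ L₂ : List (ℕ × ℕ)) (Q s : ℕ), L₁.length = 3 ∧
      ∀ (σ : ℕ → ℕ) (n : ℕ), Codes n σ → ∀ h : 1 < (L₁ ++ (0, Q * n + s) :: L₂).length,
        (ModuloInstance.Solvable ⟨L₁ ++ (0, Q * n + s) :: L₂, h⟩ ↔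
          ∃ N, (step^[N] ([p], σ)).1 = []) := by
  have hfin : (insert [] (labels p [])).Finite := (finite_labels p []).insert _
  obtain ⟨Q, e, d, hQ, hd, he⟩ := exists_numbering hfin
  obtain ⟨M, A, B, hQM, hM, hAB⟩ := exists_arith_affine hQ e d
  let L := (List.range M).map fun j => (A j, B j)
  have hL : L.length = M := by simp [L]
  refine ⟨L.take 3, L.drop 4, Q, e [p], by simp [hL]; omega, fun σ n hn h => ?_⟩
  have hset : L.take 3 ++ (0, Q * n + e [p]) :: L.drop 4 = L.set 3 (0, Q * n + e [p]) := by
    rw [List.set_eq_take_append_cons_drop, if_pos (by omega)]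
  refine iterate_three_eq_two_iff hd he (Set.mem_insert _ _) ?_ (fun x hx => ?_)
    (Set.mem_insert_of_mem _ (mem_labels_self p [])) ⟨n, hn, ?_⟩
  · rintro ⟨K, τ⟩ (rfl | hK)
    · exact Or.inl rfl
    · exact step_mem_labels p hK τ
  -- Since `Q ∣ M` and `3 < Q`, `x % M = 3` would force `x % Q = 3`, so the altered pair is not used
  -- at `x`.
  · have h3 : 3 ≠ x % M := fun h3 => by
      have := Nat.mod_mod_of_dvd x hQM
      rw [← h3, Nat.mod_eq_of_lt hQ] at this
      omega
    conv_rhs => rw [← Nat.div_add_mod' x M, hAB _ (Nat.mod_lt _ (by omega))]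
    simp [ModuloInstance.f, ModuloInstance.A, ModuloInstance.B, ModuloInstance.modulus,
      ModuloInstance.residue, hset, hL, h3, L]
  · simp [ModuloInstance.f, ModuloInstance.A, ModuloInstance.B, ModuloInstance.modulus,
      ModuloInstance.residue, hset, hL, Nat.mod_eq_of_lt hM]

end Cmd

/-- The program and its simulation are fixed by `D`; the input `m` enters only the pair at index
`3`, through a primitive recursive expression. -/
theorem exists_computable_solvable_iff {D : ℕ → ℕ → Bool} (hD : Primrec₂ D) :
    ∃ g : ℕ → ModuloInstance, Computable g ∧ ∀ m, (g m).Solvable ↔ ∃ k, D k m = true := by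
  obtain ⟨p, hp⟩ := Cmd.exists_search hD
  obtain ⟨L₁, L₂, Q, s, hL, h⟩ := Cmd.exists_instances p
  have hlen : ∀ x, 1 < (L₁ ++ x :: L₂).length := fun x => by simp; omega
  refine ⟨fun m => ⟨L₁ ++ (0, Q * (Nat.nth Nat.Prime 0 ^ m * Nat.nth Nat.Prime 1) + s) :: L₂,
    hlen _⟩, ?_, fun m => (h _ _ (Cmd.codes_initial m) _).trans (hp m)⟩
  have hpow : Primrec fun m => Nat.nth Nat.Prime 0 ^ m :=
    (Primrec₂.unpaired'.1 Nat.Primrec.pow).comp (Primrec.const _) Primrec.id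
  have hval : Primrec fun m => Q * (Nat.nth Nat.Prime 0 ^ m * Nat.nth Nat.Prime 1) + s :=
    Primrec.nat_add.comp (Primrec.nat_mul.comp (Primrec.const Q)
      (Primrec.nat_mul.comp hpow (Primrec.const _))) (Primrec.const s)
  exact Computable.subtype_mk primrecPred_one_lt_length
    (Primrec.list_append.comp (Primrec.const L₁)
      (Primrec.list_cons.comp ((Primrec.const 0).pair hval) (Primrec.const L₂))).to_comp

theorem mainTheorem3 : ¬ ComputablePred (fun I : ModuloInstance => I.Solvable) := by
  intro hI
  -- Halting on input `0` as a search over the bound `k` of the primitive recursive evaluator.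
  have hD : Primrec₂ fun k m : ℕ =>
      (Nat.Partrec.Code.evaln k (Denumerable.ofNat Nat.Partrec.Code m) 0).isSome :=
    Primrec.option_isSome.comp (Nat.Partrec.Code.primrec_evaln.comp
      ((Primrec.fst.pair ((Primrec.ofNat _).comp Primrec.snd)).pair (Primrec.const 0)))
  obtain ⟨g, hg, h⟩ := exists_computable_solvable_iff hD
  refine ComputablePred.halting_problem 0 (ComputablePred.computable_of_manyOneReducible
    ⟨fun c => g (Encodable.encode c), hg.comp Computable.encode, fun c => ?_⟩ hI)
  rw [h]
  simp only [Denumerable.ofNat_encode, Part.dom_iff_mem, Nat.Partrec.Code.evaln_complete,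
    Option.isSome_iff_exists, Option.mem_def]
  exact exists_comm
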